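/- Let $B$ be a nonzero unital $C^*$-algebra (for example, the bounded operators on a nonzero Hilbert space) and let $S_1,S_2\in B$ be isometries ($S_i^*S_i=1$) satisfying the Cuntz relation $S_1S_1^*+S_2S_2^*=1$. Let $\mathcal{O}_2=C^*(S_1,S_2)\subseteq B$ be the $C^*$-subalgebra that they generate. Then there is a unique $*$-automorphism $\sigma$ of $\mathcal{O}_2$ of order two such that $\sigma(S_1)=S_2$. Let $\mathcal{O}_2\rtimes_\sigma\mathbb{Z}_2$ be the $C^*$-crossed product, that is, the universal unital $C^*$-algebra generated by a copy of $\mathcal{O}_2$ and a unitary $W$ (the canonical unitary) with $W^2=1$ and $WaW^*=\sigma(a)$ for all $a\in\mathcal{O}_2$. Then: 1. $\mathcal{O}_2\rtimes_\sigma\mathbb{Z}_2$ is $*$-isomorphic to $\mathcal{O}_2$; 2. $\mathcal{O}_2\rtimes_\sigma\mathbb{Z}_2=C^*(S_1,WS_1)$; 3. $S_1$ and $WS_1$ are isometries satisfying the Cuntz relation: $S_1^*S_1=1$, $(WS_1)^*(WS_1)=1$, and $S_1S_1^*+(WS_1)(WS_1)^*=1$. -/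

import Mathlib

universe u v

/-- `S` and `T` are isometries that satisfy the Cuntz relation `S S* + T T* = 1`. -/
structure IsCuntzPair {B : Type u} [CStarAlgebra B] (S T : B) : Prop where
  isometry_left : star S * S = 1
  isometry_right : star T * T = 1
  cuntz_relation : S * star S + T * star T = 1

/-- `C*(s)`: the unital C*-subalgebra of `B` generated by the set `s`, that is, the norm closure
of the unital *-algebra generated by `s`. -/
noncomputable def cstarGen {B : Type u} [CStarAlgebra B] (s : Set B) : StarSubalgebra ℂ B :=
  (StarAlgebra.adjoin ℂ s).topologicalClosure

theorem subset_cstarGen {B : Type u} [CStarAlgebra B] (s : Set B) : s ⊆ cstarGen s :=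
  (StarAlgebra.subset_adjoin ℂ s).trans (StarSubalgebra.le_topologicalClosure _)

instance isClosed_cstarGen {B : Type u} [CStarAlgebra B] (s : Set B) :
    IsClosed (cstarGen s : Set B) :=
  StarSubalgebra.isClosed_topologicalClosure _

/-- The C*-algebra `C*(S, T)` as a type. When `(S, T)` is a Cuntz pair in a nonzero C*-algebra,
this is the Cuntz algebra `𝒪₂`. -/
abbrev CStarPair {B : Type u} [CStarAlgebra B] (S T : B) : Type u :=
  cstarGen ({S, T} : Set B)

/-- `S` as an element of `C*(S, T)`. -/
def CStarPair.fst {B : Type u} [CStarAlgebra B] (S T : B) : CStarPair S T :=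
  ⟨S, subset_cstarGen _ (Set.mem_insert _ _)⟩

/-- `T` as an element of `C*(S, T)`. -/
def CStarPair.snd {B : Type u} [CStarAlgebra B] (S T : B) : CStarPair S T :=
  ⟨T, subset_cstarGen _ (Set.mem_insert_of_mem _ rfl)⟩

section CrossedProduct

variable {A : Type u} [CStarAlgebra A]

theorem StarAlgEquiv.apply_apply_of_sq_eq_one {σ : A ≃⋆ₐ[ℂ] A} (hσ : σ ^ 2 = 1) (a : A) :
    σ (σ a) = a := by
  have h := congrArg (fun τ : A ≃⋆ₐ[ℂ] A => τ a) hσ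
  simpa [pow_two] using h

/-- The regular representation of the crossed product of `A` by the action of `ℤ/2` given by `σ`,
inside `M₂(A)`: the element `a + bW` is the matrix with rows `(a, b)` and `(σ b, σ a)`. -/
def crossedProductSubalgebra (σ : A ≃⋆ₐ[ℂ] A) (hσ : σ ^ 2 = 1) :
    StarSubalgebra ℂ (CStarMatrix (Fin 2) (Fin 2) A) where
  carrier := {M | M 1 1 = σ (M 0 0) ∧ M 1 0 = σ (M 0 1)}
  mul_mem' := by
    rintro M N ⟨h1, h2⟩ ⟨h3, h4⟩
    have hh := StarAlgEquiv.apply_apply_of_sq_eq_one hσ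
    constructor <;>
      simp [CStarMatrix.mul_apply, Fin.sum_univ_two, h1, h2, h3, h4, hh, add_comm]
  add_mem' := by
    rintro M N ⟨h1, h2⟩ ⟨h3, h4⟩
    constructor <;> simp [h1, h2, h3, h4]
  algebraMap_mem' := by
    intro r
    constructor <;> simp [CStarMatrix.algebraMap_apply, Algebra.algebraMap_eq_smul_one]
  star_mem' := by
    rintro M ⟨h1, h2⟩
    have hh := StarAlgEquiv.apply_apply_of_sq_eq_one hσ
    constructor
    · simp [CStarMatrix.star_apply, h1, map_star]
    · simp [CStarMatrix.star_apply, h2, map_star, hh]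

theorem mem_crossedProductSubalgebra {σ : A ≃⋆ₐ[ℂ] A} {hσ : σ ^ 2 = 1}
    {M : CStarMatrix (Fin 2) (Fin 2) A} :
    M ∈ crossedProductSubalgebra σ hσ ↔ M 1 1 = σ (M 0 0) ∧ M 1 0 = σ (M 0 1) := Iff.rfl

/-- The C*-crossed product `A ⋊_σ ℤ/2` of a unital C*-algebra `A` by the action of `ℤ/2` given by
a *-automorphism `σ` with `σ² = 1`. Its universal property is
`CrossedProduct.existsUnique_lift`. -/
def CrossedProduct (σ : A ≃⋆ₐ[ℂ] A) (hσ : σ ^ 2 = 1) : Type u :=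
  crossedProductSubalgebra σ hσ

namespace CrossedProduct

variable (σ : A ≃⋆ₐ[ℂ] A) (hσ : σ ^ 2 = 1)

noncomputable instance : CStarAlgebra (CrossedProduct σ hσ) :=
  letI : PartialOrder A := CStarAlgebra.spectralOrder A
  letI : StarOrderedRing A := CStarAlgebra.spectralOrderedRing A
  have hc : IsClosed (crossedProductSubalgebra σ hσ : Set (CStarMatrix (Fin 2) (Fin 2) A)) := by
    have he : ∀ i j : Fin 2, Continuous fun M : CStarMatrix (Fin 2) (Fin 2) A => M i j :=
      fun i j => (continuous_apply j).comp (continuous_apply i)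
    have hs : Continuous σ := (StarAlgEquiv.isometry σ).continuous
    exact (isClosed_eq (he 1 1) (hs.comp (he 0 0))).inter
      (isClosed_eq (he 1 0) (hs.comp (he 0 1)))
  StarSubalgebra.cstarAlgebra (crossedProductSubalgebra σ hσ) (h_closed := hc)

/-- The element `a + bW` of `A ⋊_σ ℤ/2`. -/
def mk (a b : A) : CrossedProduct σ hσ :=
  ⟨CStarMatrix.ofMatrix !![a, b; σ b, σ a], by simp [mem_crossedProductSubalgebra]⟩

theorem exists_eq_mk (x : CrossedProduct σ hσ) : ∃ a b, x = mk σ hσ a b := by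
  obtain ⟨M, h1, h2⟩ := x
  refine ⟨M 0 0, M 0 1, Subtype.ext ?_⟩
  ext i j
  fin_cases i <;> fin_cases j
  exacts [rfl, rfl, h2, h1]

theorem mk_inj {a b c d : A} (h : mk σ hσ a b = mk σ hσ c d) : a = c ∧ b = d :=
  ⟨congrArg (fun x : CrossedProduct σ hσ => x.1 0 0) h,
    congrArg (fun x : CrossedProduct σ hσ => x.1 0 1) h⟩

theorem mk_add (a b c d : A) : mk σ hσ a b + mk σ hσ c d = mk σ hσ (a + c) (b + d) := by
  refine Subtype.ext ?_
  change CStarMatrix.ofMatrix _ + CStarMatrix.ofMatrix _ = CStarMatrix.ofMatrix _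
  ext i j
  fin_cases i <;> fin_cases j <;> simp

theorem mk_mul (a b c d : A) :
    mk σ hσ a b * mk σ hσ c d = mk σ hσ (a * c + b * σ d) (a * d + b * σ c) := by
  have hh := StarAlgEquiv.apply_apply_of_sq_eq_one hσ
  refine Subtype.ext ?_
  change CStarMatrix.ofMatrix _ * CStarMatrix.ofMatrix _ = CStarMatrix.ofMatrix _
  ext i j
  fin_cases i <;> fin_cases j <;>
    simp [CStarMatrix.mul_apply, Fin.sum_univ_two, hh, add_comm]

theorem mk_star (a b : A) : star (mk σ hσ a b) = mk σ hσ (star a) (σ (star b)) := by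
  have hh := StarAlgEquiv.apply_apply_of_sq_eq_one hσ
  refine Subtype.ext ?_
  change star (CStarMatrix.ofMatrix _) = CStarMatrix.ofMatrix _
  ext i j
  fin_cases i <;> fin_cases j <;> simp [CStarMatrix.star_apply, hh, map_star]

theorem mk_smul (r : ℂ) (a b : A) : r • mk σ hσ a b = mk σ hσ (r • a) (r • b) := by
  refine Subtype.ext ?_
  change r • CStarMatrix.ofMatrix _ = CStarMatrix.ofMatrix _
  ext i j
  fin_cases i <;> fin_cases j <;> simp

theorem mk_one : mk σ hσ 1 0 = 1 := by
  refine Subtype.ext ?_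
  change CStarMatrix.ofMatrix _ = (1 : CStarMatrix (Fin 2) (Fin 2) A)
  ext i j
  fin_cases i <;> fin_cases j <;> simp

theorem mk_zero : mk σ hσ 0 0 = 0 := by
  refine Subtype.ext ?_
  change CStarMatrix.ofMatrix _ = (0 : CStarMatrix (Fin 2) (Fin 2) A)
  ext i j
  fin_cases i <;> fin_cases j <;> simp

/-- The canonical embedding `A → A ⋊_σ ℤ/2`. -/
noncomputable def ι : A →⋆ₐ[ℂ] CrossedProduct σ hσ where
  toFun a := mk σ hσ a 0
  map_one' := mk_one σ hσ
  map_mul' a b := by simp [mk_mul]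
  map_zero' := mk_zero σ hσ
  map_add' a b := by simp [mk_add]
  commutes' r := by
    simp only [Algebra.algebraMap_eq_smul_one]
    rw [← mk_one, mk_smul, smul_zero]
  map_star' a := by simp [mk_star]

/-- The canonical unitary of `A ⋊_σ ℤ/2`. -/
noncomputable def W : CrossedProduct σ hσ := mk σ hσ 0 1

theorem ι_apply (a : A) : ι σ hσ a = mk σ hσ a 0 := rfl

theorem W_mem_unitary : W σ hσ ∈ unitary (CrossedProduct σ hσ) := by
  rw [Unitary.mem_iff]
  simp [W, mk_star, mk_mul, mk_one]

theorem W_sq : W σ hσ ^ 2 = 1 := by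
  simp [W, pow_two, mk_mul, mk_one]

theorem covariance (a : A) : W σ hσ * ι σ hσ a * star (W σ hσ) = ι σ hσ (σ a) := by
  simp [W, ι_apply, mk_mul, mk_star]

theorem mk_eq (a b : A) : mk σ hσ a b = ι σ hσ a + ι σ hσ b * W σ hσ := by
  simp [W, ι_apply, mk_mul, mk_add]

/-- The universal property of `A ⋊_σ ℤ/2`: unital *-homomorphisms to a unital C*-algebra `D`
correspond to covariant pairs, that is, to a unital *-homomorphism `φ : A → D` and a unitary
`w` of `D` with `w² = 1` and `w φ(a) w* = φ(σ a)` for all `a`. -/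
theorem existsUnique_lift {D : Type v} [CStarAlgebra D] (φ : A →⋆ₐ[ℂ] D) (w : D)
    (hw : w ∈ unitary D) (hw2 : w ^ 2 = 1) (hφ : ∀ a, w * φ a * star w = φ (σ a)) :
    ∃! ψ : CrossedProduct σ hσ →⋆ₐ[ℂ] D, (∀ a, ψ (ι σ hσ a) = φ a) ∧ ψ (W σ hσ) = w := by
  have hw1 : star w * w = 1 := (Unitary.mem_iff.1 hw).1
  have hww : w * w = 1 := by rw [← pow_two, hw2]
  have hws : star w = w := by
    calc star w = star w * (w * w) := by rw [hww, mul_one]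
      _ = w := by rw [← mul_assoc, hw1, one_mul]
  have hc : ∀ a, w * φ a = φ (σ a) * w := fun a => by
    rw [← hφ a, mul_assoc, hw1, mul_one]
  let f : CrossedProduct σ hσ → D := fun x => φ (x.1 0 0) + φ (x.1 0 1) * w
  have hf : ∀ a b, f (mk σ hσ a b) = φ a + φ b * w := fun a b => rfl
  have hh := StarAlgEquiv.apply_apply_of_sq_eq_one hσ
  let ψ : CrossedProduct σ hσ →⋆ₐ[ℂ] D :=
    { toFun := f
      map_one' := by rw [← mk_one, hf]; simp
      map_zero' := by rw [← mk_zero, hf]; simp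
      map_add' := by
        intro x y
        obtain ⟨a, b, rfl⟩ := exists_eq_mk σ hσ x
        obtain ⟨c, d, rfl⟩ := exists_eq_mk σ hσ y
        rw [mk_add, hf, hf, hf, map_add, map_add, add_mul]
        abel
      map_mul' := by
        intro x y
        obtain ⟨a, b, rfl⟩ := exists_eq_mk σ hσ x
        obtain ⟨c, d, rfl⟩ := exists_eq_mk σ hσ y
        rw [mk_mul, hf, hf, hf]
        have e1 : φ b * w * φ c = φ b * φ (σ c) * w := by rw [mul_assoc, hc, mul_assoc]
        have e2 : φ b * w * (φ d * w) = φ b * φ (σ d) := by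
          rw [mul_assoc, ← mul_assoc w, hc, mul_assoc, hww, mul_one]
        rw [mul_add, add_mul, add_mul, e1, e2]
        simp only [map_add, map_mul, add_mul, mul_assoc]
        abel
      commutes' := by
        intro r
        rw [Algebra.algebraMap_eq_smul_one, ← mk_one, mk_smul, hf]
        simp [Algebra.algebraMap_eq_smul_one]
      map_star' := by
        intro x
        obtain ⟨a, b, rfl⟩ := exists_eq_mk σ hσ x
        rw [mk_star, hf, hf, star_add, star_mul, hws, ← map_star, ← map_star, hc] }
  refine ⟨ψ, ⟨fun a => ?_, ?_⟩, ?_⟩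
  · change f (mk σ hσ a 0) = φ a
    rw [hf]; simp
  · change f (mk σ hσ 0 1) = w
    rw [hf]; simp
  · rintro χ ⟨h1, h2⟩
    ext x
    obtain ⟨a, b, rfl⟩ := exists_eq_mk σ hσ x
    change _ = f _
    rw [hf, mk_eq, map_add, map_mul, h1, h1, h2]

end CrossedProduct

end CrossedProduct

/-! The theorem rests on the uniqueness of `𝒪₂`: a unital *-homomorphism `φ` into a nonzero
C*-algebra is isometric on `C*(S, T)` (`norm_map_of_mem_cstarGen`). Grade the monomials `S_μ S_ν*`
by `|μ| - |ν|`. Those with `|μ| = |ν| = n` span a matrix algebra, on which `φ` is injective, hence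
isometric. For `x = ∑ x_k` with homogeneous `x_k`, an isometry compresses `x* x` to `∑ x_k* x_k`, so
that `‖x_k‖ ≤ ‖φ x‖` (`norm_component_le`). At filtration level `N` this gives `‖x‖ ≤ (2N + 1) ‖φ
x‖`. The level of a power of `x* x` grows only linearly, so high powers and the C*-identity remove
the constant.

Two generating Cuntz pairs are then matched through their product pair (`exists_equiv`). Exchanging
`S₁` and `S₂` gives `σ`. In the crossed product, `S₁` and `W S₁` form a Cuntz pair because `W S₁ S₁*
W = S₂ S₂*`, and they generate because `W = (W S₁) S₁* + S₁ (W S₁)*`; uniqueness applies again. -/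

section Monomials

/-! ### Spans of monomials as products of submodules -/

theorem pow_mul_pow_le_of_mul_le {R : Type*} [Semiring R] [PartialOrder R] [IsOrderedRing R]
    [CanonicallyOrderedAdd R] {p q : R} (h : q * p ≤ p * q) (m n : ℕ) :
    q ^ m * p ^ n ≤ p ^ n * q ^ m := by
  have h1 : q * p ^ n ≤ p ^ n * q := by
    induction n with
    | zero => simp
    | succ n ih =>
      calc q * p ^ (n + 1) = q * p ^ n * p := by rw [pow_succ, mul_assoc]
        _ ≤ p ^ n * q * p := by gcongr
        _ = p ^ n * (q * p) := mul_assoc _ _ _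
        _ ≤ p ^ n * (p * q) := by gcongr
        _ = p ^ (n + 1) * q := by rw [pow_succ, mul_assoc]
  induction m with
  | zero => simp
  | succ m ih =>
    calc q ^ (m + 1) * p ^ n = q ^ m * (q * p ^ n) := by rw [pow_succ, mul_assoc]
      _ ≤ q ^ m * (p ^ n * q) := by gcongr
      _ = q ^ m * p ^ n * q := (mul_assoc _ _ _).symm
      _ ≤ p ^ n * q ^ m * q := by gcongr
      _ = p ^ n * q ^ (m + 1) := by rw [pow_succ, mul_assoc]

variable {A : Type u} [CStarAlgebra A]

/-- The linear span of `S` and `T`. -/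
noncomputable def pairSpan (S T : A) : Submodule ℂ A := Submodule.span ℂ {S, T}

theorem left_mem_pairSpan (S T : A) : S ∈ pairSpan S T :=
  Submodule.subset_span (Set.mem_insert _ _)

theorem right_mem_pairSpan (S T : A) : T ∈ pairSpan S T :=
  Submodule.subset_span (Set.mem_insert_of_mem _ rfl)

theorem mem_pairSpan {S T x : A} : x ∈ pairSpan S T ↔ ∃ a b : ℂ, a • S + b • T = x :=
  Submodule.mem_span_pair

theorem star_mem_pairSpan_pow {S T x : A} {n : ℕ} (hx : x ∈ pairSpan S T ^ n) :
    star x ∈ pairSpan (star S) (star T) ^ n := by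
  induction n generalizing x with
  | zero =>
    rw [pow_zero] at hx ⊢
    obtain ⟨c, rfl⟩ := Submodule.mem_one.1 hx
    exact Submodule.mem_one.2 ⟨star c, algebraMap_star_comm c⟩
  | succ n ih =>
    rw [pow_succ] at hx
    rw [pow_succ']
    refine Submodule.mul_induction_on hx ?_ ?_
    · intro p hp s hs
      obtain ⟨a, b, rfl⟩ := mem_pairSpan.1 hs
      rw [star_mul]
      refine Submodule.mul_mem_mul (mem_pairSpan.2 ⟨star a, star b, ?_⟩) (ih hp)
      simp
    · intro x y hx hy
      rw [star_add]; exact add_mem hx hy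

theorem star_mem_pairSpan_pow_of_star {S T x : A} {n : ℕ}
    (hx : x ∈ pairSpan (star S) (star T) ^ n) : star x ∈ pairSpan S T ^ n := by
  simpa using star_mem_pairSpan_pow hx

/-- The span of the monomials `S_μ S_ν*` with `μ` of length `m` and `ν` of length `n`. -/
noncomputable def monomialSpan (S T : A) (m n : ℕ) : Submodule ℂ A :=
  pairSpan S T ^ m * pairSpan (star S) (star T) ^ n

theorem star_mem_monomialSpan {S T x : A} {m n : ℕ} (hx : x ∈ monomialSpan S T m n) :
    star x ∈ monomialSpan S T n m := by
  unfold monomialSpan at hx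
  refine Submodule.mul_induction_on hx ?_ ?_
  · intro p hp q hq
    rw [star_mul]
    exact Submodule.mul_mem_mul (star_mem_pairSpan_pow_of_star hq) (star_mem_pairSpan_pow hp)
  · intro x y hx hy
    rw [star_add]; exact add_mem hx hy

end Monomials

/-! ### Monomial calculus for a Cuntz pair, and compression by isometries -/

namespace IsCuntzPair

variable {A : Type u} [CStarAlgebra A] {S T : A} (h : IsCuntzPair S T)
include h

theorem symm : IsCuntzPair T S :=
  ⟨h.isometry_right, h.isometry_left, by rw [add_comm]; exact h.cuntz_relation⟩

theorem star_right_mul_left : star T * S = 0 := by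
  have h1 : star S * (S * star S + T * star T) * S = 1 := by
    rw [h.cuntz_relation, mul_one, h.isometry_left]
  have h2 : star S * (S * star S + T * star T) * S = 1 + star (star T * S) * (star T * S) := by
    calc _ = (star S * S) * (star S * S) + star S * T * (star T * S) := by noncomm_ring
      _ = _ := by rw [h.isometry_left]; simp
  rw [h1] at h2
  exact CStarRing.star_mul_self_eq_zero_iff _ |>.1 (left_eq_add.1 h2)

theorem star_left_mul_right : star S * T = 0 := h.symm.star_right_mul_left

theorem ne [Nontrivial A] : S ≠ T := fun e => by
  have := h.star_left_mul_right
  rw [← e, h.isometry_left] at this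
  exact one_ne_zero this

theorem pairSpan_star_mul_pairSpan_le : pairSpan (star S) (star T) * pairSpan S T ≤ 1 := by
  rw [Submodule.mul_le]
  intro q hq p hp
  obtain ⟨a, b, rfl⟩ := mem_pairSpan.1 hq
  obtain ⟨c, d, rfl⟩ := mem_pairSpan.1 hp
  refine Submodule.mem_one.2 ⟨a * c + b * d, ?_⟩
  simp only [add_mul, mul_add, smul_mul_smul_comm, h.isometry_left, h.isometry_right,
    h.star_left_mul_right, h.star_right_mul_left, Algebra.algebraMap_eq_smul_one]
  module

theorem one_le_pairSpan_mul : 1 ≤ pairSpan S T * pairSpan (star S) (star T) := by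
  rw [Submodule.one_le, ← h.cuntz_relation]
  exact add_mem (Submodule.mul_mem_mul (left_mem_pairSpan _ _) (left_mem_pairSpan _ _))
    (Submodule.mul_mem_mul (right_mem_pairSpan _ _) (right_mem_pairSpan _ _))

theorem pairSpan_star_pow_mul_pow_le (n : ℕ) :
    pairSpan (star S) (star T) ^ n * pairSpan S T ^ n ≤ 1 := by
  induction n with
  | zero => simp
  | succ n ih =>
    calc _ = pairSpan (star S) (star T) ^ n * (pairSpan (star S) (star T) * pairSpan S T) *
          pairSpan S T ^ n := by rw [pow_succ, pow_succ']; simp only [mul_assoc]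
      _ ≤ pairSpan (star S) (star T) ^ n * 1 * pairSpan S T ^ n := by
        gcongr; exact h.pairSpan_star_mul_pairSpan_le
      _ ≤ 1 := by rwa [mul_one]

theorem one_le_monomialSpan (n : ℕ) : 1 ≤ monomialSpan S T n n := by
  unfold monomialSpan
  induction n with
  | zero => simp
  | succ n ih =>
    calc (1 : Submodule ℂ A) ≤ pairSpan S T ^ n * 1 * pairSpan (star S) (star T) ^ n := by
          rwa [mul_one]
      _ ≤ pairSpan S T ^ n * (pairSpan S T * pairSpan (star S) (star T)) *
          pairSpan (star S) (star T) ^ n := by gcongr; exact h.one_le_pairSpan_mul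
      _ = _ := by rw [pow_succ, pow_succ']; simp only [mul_assoc]

/-- The Cuntz relation, iterated `k` times, expands the unit between the two factors of a monomial;
the degree `m - n` is unchanged. -/
theorem monomialSpan_le (m n k : ℕ) : monomialSpan S T m n ≤ monomialSpan S T (m + k) (n + k) :=
  calc monomialSpan S T m n
      = pairSpan S T ^ m * 1 * pairSpan (star S) (star T) ^ n := by rw [mul_one]; rfl
    _ ≤ pairSpan S T ^ m * monomialSpan S T k k * pairSpan (star S) (star T) ^ n := by
      gcongr; exact h.one_le_monomialSpan k
    _ = _ := by rw [monomialSpan, monomialSpan, pow_add, add_comm n, pow_add]; simp only [mul_assoc]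

theorem monomialSpan_mul_le (m n k l : ℕ) :
    monomialSpan S T m n * monomialSpan S T k l ≤ monomialSpan S T (m + k) (n + l) :=
  calc _ = pairSpan S T ^ m * (pairSpan (star S) (star T) ^ n * pairSpan S T ^ k) *
        pairSpan (star S) (star T) ^ l := by simp only [monomialSpan, mul_assoc]
    _ ≤ pairSpan S T ^ m * (pairSpan S T ^ k * pairSpan (star S) (star T) ^ n) *
        pairSpan (star S) (star T) ^ l := by
      refine mul_le_mul' (mul_le_mul' le_rfl ?_) le_rfl
      -- In the ordered semiring of submodules, `q p ≤ 1 ≤ p q` holds for the span `p` of `S, T` and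
      -- the span `q` of their adjoints.
      exact pow_mul_pow_le_of_mul_le
        (h.pairSpan_star_mul_pairSpan_le.trans h.one_le_pairSpan_mul) _ _
    _ = _ := by simp only [monomialSpan, pow_add, mul_assoc]

/-- Cancellation of the inner factors in a product of monomials. -/
theorem monomialSpan_mul_add_le (m n k l : ℕ) :
    monomialSpan S T m n * monomialSpan S T (n + k) l ≤ monomialSpan S T (m + k) l :=
  calc _ = pairSpan S T ^ m * (pairSpan (star S) (star T) ^ n * pairSpan S T ^ n) *
        pairSpan S T ^ k * pairSpan (star S) (star T) ^ l := by
        simp only [monomialSpan, pow_add, mul_assoc]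
    _ ≤ pairSpan S T ^ m * 1 * pairSpan S T ^ k * pairSpan (star S) (star T) ^ l := by
      gcongr; exact h.pairSpan_star_pow_mul_pow_le n
    _ = _ := by simp only [monomialSpan, pow_add, mul_one]

/-- Take `r = S ^ M * T`. For `b` of length `m ≤ M`, `S*^m b` is a scalar `c`, so `r* b r = c T* S^m
T`, which vanishes because `m ≥ 1` and `T* S = 0`. -/
theorem exists_isometry_conj_eq_zero (M : ℕ) : ∃ r : A, star r * r = 1 ∧
    ∀ m, 1 ≤ m → m ≤ M → ∀ b ∈ pairSpan S T ^ m, star r * b * r = 0 := by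
  have hS : ∀ n : ℕ, star S ^ n * S ^ n = 1 := fun n => by
    induction n with
    | zero => simp
    | succ n ih =>
      rw [pow_succ, pow_succ', mul_assoc, ← mul_assoc (star S), h.isometry_left, one_mul, ih]
  refine ⟨S ^ M * T, ?_, fun m hm hM b hb => ?_⟩
  · rw [star_mul, star_pow, mul_assoc, ← mul_assoc (star S ^ M), hS, one_mul, h.isometry_right]
  · have hb' : star S ^ m * b ∈ (1 : Submodule ℂ A) := h.pairSpan_star_pow_mul_pow_le m
      (Submodule.mul_mem_mul (Submodule.pow_mem_pow _ (left_mem_pairSpan _ _) m) hb)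
    obtain ⟨c, hc⟩ := Submodule.mem_one.1 hb'
    obtain ⟨k, rfl⟩ := Nat.exists_eq_add_of_le' hM
    obtain ⟨m, rfl⟩ := Nat.exists_eq_add_of_le' hm
    calc star (S ^ (k + (m + 1)) * T) * b * (S ^ (k + (m + 1)) * T)
        = star T * star S ^ k * (star S ^ (m + 1) * b) * (S ^ k * S ^ (m + 1) * T) := by
          rw [star_mul, star_pow, pow_add (star S), pow_add S]; simp only [mul_assoc]
      _ = c • (star T * (star S ^ k * S ^ k) * S ^ (m + 1) * T) := by
          rw [← hc, Algebra.algebraMap_eq_smul_one]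
          simp only [mul_smul_comm, smul_mul_assoc, mul_one, mul_assoc]
      _ = c • (star T * S * S ^ m * T) := by rw [hS, mul_one, pow_succ']; simp only [mul_assoc]
      _ = 0 := by rw [h.star_right_mul_left]; simp

/-- The isometry is `∑ S_μ r S_μ*` over words `μ` of length `N`, built by iterating `w ↦ S w S* + T
w T*`. -/
theorem exists_isometry_intertwining (N : ℕ) {r : A} (hr : star r * r = 1) :
    ∃ w : A, star w * w = 1 ∧ ∀ p ∈ pairSpan S T ^ N, star w * p = p * star r := by
  induction N with
  | zero =>
    refine ⟨r, hr, fun p hp => ?_⟩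
    rw [pow_zero] at hp
    obtain ⟨c, rfl⟩ := Submodule.mem_one.1 hp
    exact (Algebra.commutes c _).symm
  | succ N ih =>
    obtain ⟨w, hw, hwp⟩ := ih
    have hst : star (S * w * star S + T * w * star T) =
        S * star w * star S + T * star w * star T := by
      simp [mul_assoc]
    have e1 : (S * star w * star S + T * star w * star T) * S = S * star w := by
      rw [add_mul, mul_assoc _ _ S, mul_assoc _ _ S, h.isometry_left, h.star_right_mul_left]; simp
    have e2 : (S * star w * star S + T * star w * star T) * T = T * star w := by
      rw [add_mul, mul_assoc _ _ T, mul_assoc _ _ T, h.isometry_right, h.star_left_mul_right]; simp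
    refine ⟨S * w * star S + T * w * star T, ?_, fun p hp => ?_⟩
    · rw [hst, mul_add, ← mul_assoc, ← mul_assoc, ← mul_assoc, ← mul_assoc, e1, e2,
        mul_assoc S, mul_assoc T, hw, mul_one, mul_one, h.cuntz_relation]
    · rw [hst]
      rw [pow_succ'] at hp
      refine Submodule.mul_induction_on hp ?_ ?_
      · intro s hs p hp
        obtain ⟨a, b, rfl⟩ := mem_pairSpan.1 hs
        rw [← mul_assoc, mul_add, mul_smul_comm, mul_smul_comm, e1, e2, ← smul_mul_assoc,
          ← smul_mul_assoc, ← add_mul, mul_assoc, hwp p hp, mul_assoc]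
      · intro x y hx hy
        rw [mul_add, hx, hy, add_mul]

/-- Compression by a suitable isometry kills the off-diagonal part of `x* x`. -/
theorem exists_isometry_compression {N : ℕ} {x : ℕ → A}
    (hx : ∀ k, x k ∈ monomialSpan S T k N) (M : ℕ) :
    ∃ w : A, star w * w = 1 ∧
      star w * (star (∑ k ∈ Finset.range M, x k) * ∑ k ∈ Finset.range M, x k) * w =
        ∑ k ∈ Finset.range M, star (x k) * x k := by
  obtain ⟨r, hr, hr0⟩ := h.exists_isometry_conj_eq_zero M
  obtain ⟨w, hw, hwp⟩ := h.exists_isometry_intertwining N hr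
  have hwq : ∀ q ∈ pairSpan (star S) (star T) ^ N, q * w = r * q := fun q hq => by
    simpa using congrArg star (hwp _ (star_mem_pairSpan_pow_of_star hq))
  -- `w* (p q) w = p r* r q = p q`.
  have hdiag : ∀ y ∈ monomialSpan S T N N, star w * y * w = y := fun y hy => by
    unfold monomialSpan at hy
    refine Submodule.mul_induction_on hy ?_ ?_
    · intro p hp q hq
      rw [← mul_assoc, hwp p hp, mul_assoc, hwq q hq, mul_assoc, ← mul_assoc (star r), hr, one_mul]
    · intro x y hx hy
      rw [mul_add, add_mul, hx, hy]
  -- `w* (p b q) w = p (r* b r) q`, and the middle factor is zero by the choice of `r`.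
  have hoff : ∀ m, 1 ≤ m → m ≤ M → ∀ y ∈ monomialSpan S T (N + m) N, star w * y * w = 0 :=
    fun m h1 hM y hy => by
    unfold monomialSpan at hy
    refine Submodule.mul_induction_on hy ?_ ?_
    · intro p hp q hq
      rw [mul_assoc, mul_assoc, hwq q hq, ← mul_assoc, ← mul_assoc]
      suffices star w * p * r = 0 by rw [this, zero_mul]
      rw [pow_add] at hp
      refine Submodule.mul_induction_on hp ?_ ?_
      · intro p hp b hb
        rw [← mul_assoc, hwp p hp, mul_assoc, mul_assoc, ← mul_assoc (star r), hr0 m h1 hM b hb,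
          mul_zero]
      · intro x y hx hy
        rw [mul_add, add_mul, hx, hy, add_zero]
    · intro x y hx hy
      rw [mul_add, add_mul, hx, hy, add_zero]
  have hlt : ∀ j k, j < k → k < M → star w * (star (x j) * x k) * w = 0 := fun j k hjk hk => by
    obtain ⟨m, rfl⟩ := Nat.exists_eq_add_of_lt hjk
    refine hoff (m + 1) (by omega) (by omega) _ ?_
    exact h.monomialSpan_mul_add_le N j (m + 1) N
      (Submodule.mul_mem_mul (star_mem_monomialSpan (hx j)) (hx (j + (m + 1))))
  refine ⟨w, hw, ?_⟩
  rw [star_sum, Finset.sum_mul_sum, Finset.mul_sum, Finset.sum_mul]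
  refine Finset.sum_congr rfl fun j hj => ?_
  rw [Finset.mul_sum, Finset.sum_mul, Finset.sum_eq_single_of_mem j hj]
  · exact hdiag _ (h.monomialSpan_mul_add_le N j 0 N
      (Submodule.mul_mem_mul (star_mem_monomialSpan (hx j)) (hx j)))
  · intro k hk hkj
    rw [Finset.mem_range] at hj hk
    rcases lt_or_gt_of_ne hkj with hlt' | hlt'
    · have := congrArg star (hlt k j hlt' hj)
      simpa [mul_assoc] using this
    · exact hlt j k hlt' hk

end IsCuntzPair

/-! ### Norm estimates for homogeneous components -/

namespace IsCuntzPair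

variable {A : Type u} [CStarAlgebra A] {S T : A} (h : IsCuntzPair S T)
include h

/-- The matrix algebra spanned by the monomials `S_μ S_ν*` with `μ` and `ν` of length `n`. -/
noncomputable def matrixSubalgebra (n : ℕ) : StarSubalgebra ℂ A where
  carrier := monomialSpan S T n n
  mul_mem' ha hb := h.monomialSpan_mul_add_le n n 0 n (Submodule.mul_mem_mul ha hb)
  add_mem' ha hb := add_mem ha hb
  algebraMap_mem' c := h.one_le_monomialSpan n (Submodule.mem_one.2 ⟨c, rfl⟩)
  star_mem' ha := star_mem_monomialSpan ha

theorem isClosed_matrixSubalgebra (n : ℕ) : IsClosed (h.matrixSubalgebra n : Set A) := by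
  have hfg : ∀ U V : A, (pairSpan U V).FG := fun U V => Submodule.fg_span (Set.toFinite _)
  have : FiniteDimensional ℂ (monomialSpan S T n n) :=
    Module.Finite.iff_fg.2 (((hfg S T).pow n).mul ((hfg _ _).pow n))
  exact Submodule.closed_of_finiteDimensional (monomialSpan S T n n)

variable {D : Type v} [CStarAlgebra D] [Nontrivial D] (φ : A →⋆ₐ[ℂ] D)

/-- Induction on `n`: the four corners `u* y v` with `u, v ∈ {S, T}` lie one level lower and are
killed by `φ`, and they determine `y` by the Cuntz relation. At level zero only scalars remain, and
these embed in the nonzero `D`. -/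
theorem eq_zero_of_map_eq_zero {n : ℕ} {y : A} (hy : y ∈ monomialSpan S T n n) (h0 : φ y = 0) :
    y = 0 := by
  induction n generalizing y with
  | zero =>
    rw [monomialSpan, pow_zero, pow_zero, mul_one] at hy
    obtain ⟨c, rfl⟩ := Submodule.mem_one.1 hy
    rw [AlgHomClass.commutes, FaithfulSMul.algebraMap_eq_zero_iff] at h0
    rw [h0, map_zero]
  | succ n ih =>
    have key : ∀ u ∈ pairSpan S T, ∀ v ∈ pairSpan S T, star u * y * v = 0 := fun u hu v hv => by
      refine ih ?_ (by rw [map_mul, map_mul, h0, mul_zero, zero_mul])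
      have hu' : star u ∈ monomialSpan S T 0 1 := by
        rw [monomialSpan, pow_zero, one_mul]
        exact star_mem_pairSpan_pow (by rwa [pow_one])
      have hv' : v ∈ monomialSpan S T 1 0 := by
        rwa [monomialSpan, pow_zero, mul_one, pow_one]
      have h1 : star u * y ∈ monomialSpan S T n (n + 1) := by
        have := h.monomialSpan_mul_add_le 0 1 n (n + 1)
          (Submodule.mul_mem_mul hu' (by rwa [add_comm 1 n]))
        rwa [zero_add] at this
      have h2 := h.monomialSpan_mul_add_le 0 1 n n (Submodule.mul_mem_mul
        (star_mem_monomialSpan hv') (by rw [add_comm 1 n]; exact star_mem_monomialSpan h1))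
      rw [zero_add] at h2
      simpa using star_mem_monomialSpan h2
    have hl := left_mem_pairSpan S T
    have hr := right_mem_pairSpan S T
    calc y = (S * star S + T * star T) * y * (S * star S + T * star T) := by
          rw [h.cuntz_relation, one_mul, mul_one]
      _ = S * (star S * y * S) * star S + S * (star S * y * T) * star T +
          (T * (star T * y * S) * star S + T * (star T * y * T) * star T) := by noncomm_ring
      _ = 0 := by rw [key S hl S hl, key S hl T hr, key T hr S hl, key T hr T hr]; simp

theorem norm_map_of_mem_monomialSpan {n : ℕ} {y : A} (hy : y ∈ monomialSpan S T n n) :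
    ‖φ y‖ = ‖y‖ := by
  have := h.isClosed_matrixSubalgebra n
  let : CStarAlgebra (h.matrixSubalgebra n) := StarSubalgebra.cstarAlgebra _
  let ψ : h.matrixSubalgebra n →⋆ₐ[ℂ] D := φ.comp (h.matrixSubalgebra n).subtype
  refine NonUnitalStarAlgHom.norm_map ψ ?_ ⟨y, hy⟩
  rw [injective_iff_map_eq_zero]
  rintro ⟨z, hz⟩ h0
  exact Subtype.ext (h.eq_zero_of_map_eq_zero φ hz h0)

/-- The element `x_j* x_j` lies in a matrix algebra, where `φ` preserves norms. Its image is
dominated by `∑ φ(x_k)* φ(x_k)`, which is the compression of `φ(s)* φ(s)` by the isometry `φ w`. -/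
theorem norm_component_le {N M : ℕ} {x : ℕ → A} (hx : ∀ k, x k ∈ monomialSpan S T k N) {j : ℕ}
    (hj : j < M) : ‖x j‖ ≤ ‖φ (∑ k ∈ Finset.range M, x k)‖ := by
  let : PartialOrder D := CStarAlgebra.spectralOrder D
  let : StarOrderedRing D := CStarAlgebra.spectralOrderedRing D
  obtain ⟨w, hw, hwx⟩ := h.exists_isometry_compression hx M
  set s := ∑ k ∈ Finset.range M, x k
  have hw1 : ‖φ w‖ * ‖φ w‖ = 1 := by
    rw [← CStarRing.norm_star_mul_self, ← map_star, ← map_mul, hw, map_one, CStarRing.norm_one]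
  have hmem : star (x j) * x j ∈ monomialSpan S T N N :=
    h.monomialSpan_mul_add_le N j 0 N (Submodule.mul_mem_mul (star_mem_monomialSpan (hx j)) (hx j))
  have hle : star (φ (x j)) * φ (x j) ≤ ∑ k ∈ Finset.range M, star (φ (x k)) * φ (x k) :=
    Finset.single_le_sum (f := fun k => star (φ (x k)) * φ (x k))
      (fun k _ => star_mul_self_nonneg _) (Finset.mem_range.2 hj)
  refine (mul_self_le_mul_self_iff (norm_nonneg _) (norm_nonneg _)).2 ?_
  calc ‖x j‖ * ‖x j‖ = ‖star (φ (x j)) * φ (x j)‖ := by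
        rw [← CStarRing.norm_star_mul_self, ← h.norm_map_of_mem_monomialSpan φ hmem, map_mul,
          map_star]
    _ ≤ ‖∑ k ∈ Finset.range M, star (φ (x k)) * φ (x k)‖ :=
      CStarAlgebra.norm_le_norm_of_nonneg_of_le (star_mul_self_nonneg _) hle
    _ = ‖star (φ w) * (star (φ s) * φ s) * φ w‖ := by
      congr 1
      have hs : ∀ a, φ (star a) = star (φ a) := map_star φ
      simpa only [map_mul, map_sum, hs] using (congrArg φ hwx).symm
    _ ≤ ‖star (φ w)‖ * ‖star (φ s) * φ s‖ * ‖φ w‖ :=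
      (norm_mul_le _ _).trans (mul_le_mul_of_nonneg_right (norm_mul_le _ _) (norm_nonneg _))
    _ = ‖φ w‖ * ‖φ w‖ * (‖φ s‖ * ‖φ s‖) := by
      rw [norm_star, CStarRing.norm_star_mul_self]; ring
    _ = ‖φ s‖ * ‖φ s‖ := by rw [hw1, one_mul]

end IsCuntzPair

/-! ### The filtration by length, and isometry on `C*(S, T)` -/

theorem StarAlgHom.continuous_of_cstarAlgebra {A : Type u} {D : Type v} [CStarAlgebra A]
    [CStarAlgebra D] (φ : A →⋆ₐ[ℂ] D) : Continuous φ :=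
  AddMonoidHomClass.continuous_of_bound φ 1 fun x => by
    simpa using NonUnitalStarAlgHom.norm_apply_le φ x

/-- The span of the monomials `S_μ S_ν*` with `μ` of length at most `2 N` and `ν` of length `N`. -/
noncomputable def monomialFiltration {A : Type u} [CStarAlgebra A] (S T : A) (N : ℕ) :
    Submodule ℂ A :=
  ⨆ k ∈ Finset.range (2 * N + 1), monomialSpan S T k N

theorem monomialSpan_le_filtration {A : Type u} [CStarAlgebra A] (S T : A) {k N : ℕ}
    (hk : k ≤ 2 * N) : monomialSpan S T k N ≤ monomialFiltration S T N :=
  le_iSup₂_of_le (f := fun k (_ : k ∈ Finset.range (2 * N + 1)) => monomialSpan S T k N) k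
    (Finset.mem_range.2 (by omega)) le_rfl

/-- If `b < a`, then `(b / a) ^ 2 ^ n` decays faster than the linear factor in `2 ^ n` grows,
contradicting the lower bound `1`. -/
theorem le_of_forall_pow_two_pow_le {a b : ℝ} (hb : 0 ≤ b) (C : ℝ)
    (h : ∀ n : ℕ, a ^ 2 ^ n ≤ (C * 2 ^ n + 1) * b ^ 2 ^ n) : a ≤ b := by
  by_contra! hab
  have ha0 : 0 < a := hb.trans_lt hab
  have hr0 : 0 ≤ b / a := by positivity
  have hr1 : b / a < 1 := (div_lt_one ha0).2 hab
  have hlim : Filter.Tendsto (fun m : ℕ => C * (m * (b / a) ^ m) + (b / a) ^ m) Filter.atTop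
      (nhds (C * 0 + 0)) :=
    ((tendsto_self_mul_const_pow_of_lt_one hr0 hr1).const_mul C).add
      (tendsto_pow_atTop_nhds_zero_of_lt_one hr0 hr1)
  have hlim' := hlim.comp (tendsto_pow_atTop_atTop_of_one_lt (r := 2) one_lt_two)
  have hge : ∀ n : ℕ, 1 ≤ C * ((2 ^ n : ℕ) * (b / a) ^ 2 ^ n) + (b / a) ^ 2 ^ n := fun n => by
    have e : C * ((2 ^ n : ℕ) * (b / a) ^ 2 ^ n) + (b / a) ^ 2 ^ n =
        (C * 2 ^ n + 1) * b ^ 2 ^ n / a ^ 2 ^ n := by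
      rw [div_pow]; push_cast; ring
    rw [e, one_le_div (by positivity)]
    exact h n
  have := ge_of_tendsto' hlim' hge
  norm_num at this

namespace IsCuntzPair

variable {A : Type u} [CStarAlgebra A] {S T : A} (h : IsCuntzPair S T)
include h

theorem filtration_le_add (N k : ℕ) : monomialFiltration S T N ≤ monomialFiltration S T (N + k) :=
  iSup₂_le fun j hj => (h.monomialSpan_le j N k).trans
    (monomialSpan_le_filtration S T (by rw [Finset.mem_range] at hj; omega))

theorem filtration_mono {N M : ℕ} (hNM : N ≤ M) :
    monomialFiltration S T N ≤ monomialFiltration S T M := by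
  obtain ⟨k, rfl⟩ := Nat.exists_eq_add_of_le hNM
  exact h.filtration_le_add N k

theorem filtration_mul_le (N M : ℕ) :
    monomialFiltration S T N * monomialFiltration S T M ≤ monomialFiltration S T (N + M) := by
  simp only [monomialFiltration, Submodule.iSup_mul, Submodule.mul_iSup]
  refine iSup₂_le fun j hj => iSup₂_le fun k hk => ?_
  rw [Finset.mem_range] at hj hk
  exact (h.monomialSpan_mul_le k N j M).trans (monomialSpan_le_filtration S T (by omega))

theorem pow_mem_filtration {N : ℕ} {x : A} (hx : x ∈ monomialFiltration S T N) (n : ℕ) :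
    x ^ n ∈ monomialFiltration S T (n * N) := by
  induction n with
  | zero =>
    rw [pow_zero, zero_mul]
    refine monomialSpan_le_filtration S T (k := 0) le_rfl ?_
    exact h.one_le_monomialSpan 0 (Submodule.one_le.1 le_rfl)
  | succ n ih =>
    rw [pow_succ, Nat.succ_mul]
    exact h.filtration_mul_le _ _ (Submodule.mul_mem_mul ih hx)

theorem star_mem_filtration {N : ℕ} {x : A} (hx : x ∈ monomialFiltration S T N) :
    star x ∈ monomialFiltration S T (2 * N) := by
  obtain ⟨f, rfl⟩ := (Submodule.mem_iSup_finset_iff_exists_sum _ _).1 hx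
  rw [star_sum]
  refine sum_mem fun k hk => ?_
  rw [Finset.mem_range] at hk
  -- The adjoint lies in bidegree `(N, k)`; padding by `2N - k` brings the second length to the
  -- common value `2N`.
  have := h.monomialSpan_le N k (2 * N - k) (star_mem_monomialSpan (f k).2)
  rw [show k + (2 * N - k) = 2 * N by omega] at this
  exact monomialSpan_le_filtration S T (by omega) this

theorem exists_mem_filtration {x : A} (hx : x ∈ StarAlgebra.adjoin ℂ ({S, T} : Set A)) :
    ∃ N, x ∈ monomialFiltration S T N := by
  induction hx using StarAlgebra.adjoin_induction with
  | mem x hx =>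
    -- A generator has bidegree `(1, 0)`, padded to `(2, 1)`; the bound `2 * N` leaves just enough
    -- room.
    refine ⟨1, monomialSpan_le_filtration S T (k := 2) le_rfl ?_⟩
    refine h.monomialSpan_le 1 0 1 ?_
    rw [monomialSpan, pow_one, pow_zero, mul_one]
    exact Submodule.subset_span hx
  | algebraMap c =>
    exact ⟨0, monomialSpan_le_filtration S T (k := 0) le_rfl
      (h.one_le_monomialSpan 0 (Submodule.mem_one.2 ⟨c, rfl⟩))⟩
  | add x y _ _ hx hy =>
    obtain ⟨N, hN⟩ := hx
    obtain ⟨M, hM⟩ := hy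
    exact ⟨N + M, add_mem (h.filtration_mono (by omega) hN) (h.filtration_mono (by omega) hM)⟩
  | mul x y _ _ hx hy =>
    obtain ⟨N, hN⟩ := hx
    obtain ⟨M, hM⟩ := hy
    exact ⟨N + M, h.filtration_mul_le N M (Submodule.mul_mem_mul hN hM)⟩
  | star x _ hx =>
    obtain ⟨N, hN⟩ := hx
    exact ⟨2 * N, h.star_mem_filtration hN⟩

variable {D : Type v} [CStarAlgebra D] [Nontrivial D] (φ : A →⋆ₐ[ℂ] D)

theorem norm_le_of_mem_filtration {N : ℕ} {x : A} (hx : x ∈ monomialFiltration S T N) :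
    ‖x‖ ≤ (2 * N + 1) * ‖φ x‖ := by
  obtain ⟨f, rfl⟩ := (Submodule.mem_iSup_finset_iff_exists_sum _ _).1 hx
  calc ‖∑ k ∈ Finset.range (2 * N + 1), (f k : A)‖
      ≤ ∑ k ∈ Finset.range (2 * N + 1), ‖(f k : A)‖ := norm_sum_le _ _
    _ ≤ ∑ _k ∈ Finset.range (2 * N + 1), ‖φ (∑ k ∈ Finset.range (2 * N + 1), (f k : A))‖ :=
      Finset.sum_le_sum fun k hk =>
        h.norm_component_le φ (x := fun k => (f k : A)) (fun k => (f k).2) (Finset.mem_range.1 hk)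
    _ = _ := by rw [Finset.sum_const, Finset.card_range, nsmul_eq_mul]; push_cast; rfl

theorem norm_map_of_mem_adjoin {x : A} (hx : x ∈ StarAlgebra.adjoin ℂ ({S, T} : Set A)) :
    ‖φ x‖ = ‖x‖ := by
  refine le_antisymm (NonUnitalStarAlgHom.norm_apply_le φ x) ?_
  obtain ⟨N, hN⟩ := h.exists_mem_filtration (mul_mem (star_mem hx) hx)
  refine (mul_self_le_mul_self_iff (norm_nonneg _) (norm_nonneg _)).2 ?_
  rw [← CStarRing.norm_star_mul_self, ← CStarRing.norm_star_mul_self, ← map_star, ← map_mul]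
  -- The power `(x* x) ^ 2 ^ n` has level `2 ^ n * N`, so its comparison constant is `2N * 2 ^ n +
  -- 1`.
  refine le_of_forall_pow_two_pow_le (norm_nonneg _) (2 * N) fun n => ?_
  have hsa : ‖(star x * x) ^ 2 ^ n‖ = ‖star x * x‖ ^ 2 ^ n := by
    simpa using congrArg NNReal.toReal ((IsSelfAdjoint.star_mul_self x).nnnorm_pow_two_pow n)
  calc ‖star x * x‖ ^ 2 ^ n = ‖(star x * x) ^ 2 ^ n‖ := hsa.symm
    _ ≤ (2 * (2 ^ n * N : ℕ) + 1) * ‖φ ((star x * x) ^ 2 ^ n)‖ :=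
      h.norm_le_of_mem_filtration φ (h.pow_mem_filtration hN _)
    _ ≤ (2 * (2 ^ n * N : ℕ) + 1) * ‖φ (star x * x)‖ ^ 2 ^ n := by
      rw [map_pow]; gcongr; exact norm_pow_le _ _
    _ = _ := by push_cast; ring

/-- A unital *-homomorphism to a nonzero C*-algebra is isometric on `C*(S, T)`. -/
theorem norm_map_of_mem_cstarGen {x : A} (hx : x ∈ cstarGen ({S, T} : Set A)) : ‖φ x‖ = ‖x‖ := by
  have hφ : Continuous φ := φ.continuous_of_cstarAlgebra
  have hcl : IsClosed {y : A | ‖φ y‖ = ‖y‖} := isClosed_eq hφ.norm continuous_norm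
  exact closure_minimal (fun y hy => h.norm_map_of_mem_adjoin φ hy) hcl hx

end IsCuntzPair

/-! ### Generation and density arguments -/

section Generators

variable {A : Type u} [CStarAlgebra A]

theorem cstarGen_le_of_isClosed {s : Set A} {U : StarSubalgebra ℂ A} (hs : s ⊆ U)
    (hU : IsClosed (U : Set A)) : cstarGen s ≤ U :=
  StarSubalgebra.topologicalClosure_minimal (StarAlgebra.adjoin_le hs) hU

theorem cstarGen_eq_top {S T : A} (h : ∀ U : StarSubalgebra ℂ A, IsClosed (U : Set A) →
    S ∈ U → T ∈ U → U = ⊤) : cstarGen ({S, T} : Set A) = ⊤ :=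
  h _ (isClosed_cstarGen _) (subset_cstarGen _ (Set.mem_insert _ _))
    (subset_cstarGen _ (Set.mem_insert_of_mem _ rfl))

theorem cstarGen_fst_snd (S T : A) :
    cstarGen ({CStarPair.fst S T, CStarPair.snd S T} : Set (CStarPair S T)) = ⊤ := by
  refine cstarGen_eq_top fun U hU h1 h2 => ?_
  have hcl : IsClosed ((U.map (cstarGen ({S, T} : Set A)).subtype : StarSubalgebra ℂ A) : Set A) :=
    (isClosed_cstarGen ({S, T} : Set A)).isClosedMap_subtype_val _ hU
  have hle : cstarGen ({S, T} : Set A) ≤ U.map (cstarGen ({S, T} : Set A)).subtype := by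
    refine cstarGen_le_of_isClosed ?_ hcl
    rintro x (rfl | rfl)
    exacts [⟨_, h1, rfl⟩, ⟨_, h2, rfl⟩]
  refine top_unique fun x _ => ?_
  obtain ⟨y, hy, hyx⟩ := hle x.2
  rwa [← Subtype.ext hyx]

theorem StarAlgHom.ext_of_cstarGen_eq_top {D : Type v} [CStarAlgebra D] {S T : A}
    (hg : cstarGen ({S, T} : Set A) = ⊤) {φ ψ : A →⋆ₐ[ℂ] D} (h1 : φ S = ψ S) (h2 : φ T = ψ T) :
    φ = ψ := by
  have hφ : Continuous φ := φ.continuous_of_cstarAlgebra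
  have hψ : Continuous ψ := ψ.continuous_of_cstarAlgebra
  have hle : cstarGen ({S, T} : Set A) ≤ StarAlgHom.equalizer φ ψ := by
    refine cstarGen_le_of_isClosed ?_ (isClosed_eq hφ hψ)
    rintro x (rfl | rfl)
    exacts [h1, h2]
  ext x
  exact hle (hg ▸ trivial : x ∈ cstarGen ({S, T} : Set A))

end Generators

/-! ### Uniqueness of the Cuntz algebra -/

namespace IsCuntzPair

theorem mk_subtype {A : Type u} [CStarAlgebra A] {S T : A} (h : IsCuntzPair S T) :
    IsCuntzPair (CStarPair.fst S T) (CStarPair.snd S T) :=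
  ⟨Subtype.ext h.isometry_left, Subtype.ext h.isometry_right, Subtype.ext h.cuntz_relation⟩

theorem prod {A : Type u} {D : Type v} [CStarAlgebra A] [CStarAlgebra D] {S T : A} {S' T' : D}
    (h : IsCuntzPair S T) (h' : IsCuntzPair S' T') : IsCuntzPair (S, S') (T, T') :=
  ⟨Prod.ext h.isometry_left h'.isometry_left, Prod.ext h.isometry_right h'.isometry_right,
    Prod.ext h.cuntz_relation h'.cuntz_relation⟩

/-- Being isometric on `C*(S, T)`, `φ` is injective there with closed range, and that range contains
generators of `D`. -/
theorem exists_equiv_of_hom {E : Type u} {D : Type v} [CStarAlgebra E] [CStarAlgebra D]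
    [Nontrivial D] {S T : E} (h : IsCuntzPair S T) (φ : E →⋆ₐ[ℂ] D)
    (hg : cstarGen ({φ S, φ T} : Set D) = ⊤) :
    ∃ e : CStarPair S T ≃⋆ₐ[ℂ] D,
      e (CStarPair.fst S T) = φ S ∧ e (CStarPair.snd S T) = φ T := by
  let ψ : CStarPair S T →⋆ₐ[ℂ] D := φ.comp (cstarGen ({S, T} : Set E)).subtype
  have hiso : Isometry ψ :=
    AddMonoidHomClass.isometry_of_norm ψ fun x => h.norm_map_of_mem_cstarGen φ x.2
  have hr : cstarGen ({φ S, φ T} : Set D) ≤ ψ.range := by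
    refine cstarGen_le_of_isClosed ?_ ?_
    · rintro x (rfl | rfl)
      exacts [⟨CStarPair.fst S T, rfl⟩, ⟨CStarPair.snd S T, rfl⟩]
    · exact hiso.isClosedEmbedding.isClosed_range
  rw [hg] at hr
  refine ⟨StarAlgEquiv.ofBijective ψ ⟨hiso.injective, fun d => ?_⟩, rfl, rfl⟩
  exact hr (trivial : d ∈ (⊤ : StarSubalgebra ℂ D))

/-- Uniqueness of the Cuntz algebra `𝒪₂`. -/
theorem exists_equiv {A : Type u} {D : Type v} [CStarAlgebra A] [CStarAlgebra D] [Nontrivial A]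
    [Nontrivial D] {S T : A} {S' T' : D} (h : IsCuntzPair S T) (h' : IsCuntzPair S' T')
    (hg : cstarGen ({S, T} : Set A) = ⊤) (hg' : cstarGen ({S', T'} : Set D) = ⊤) :
    ∃ e : A ≃⋆ₐ[ℂ] D, e S = S' ∧ e T = T' := by
  -- Both coordinate projections restrict to isomorphisms on the C*-algebra generated by `(S, S')`
  -- and `(T, T')` in `A × D`; one inverse followed by the other is the required map.
  obtain ⟨e, he1, he2⟩ := (h.prod h').exists_equiv_of_hom (StarAlgHom.fst ℂ A D) hg
  obtain ⟨f, hf1, hf2⟩ := (h.prod h').exists_equiv_of_hom (StarAlgHom.snd ℂ A D) hg'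
  refine ⟨e.symm.trans f, ?_, ?_⟩
  · exact (congrArg f (e.symm_apply_eq.2 he1.symm)).trans hf1
  · exact (congrArg f (e.symm_apply_eq.2 he2.symm)).trans hf2

end IsCuntzPair

/-! ### The Cuntz pair in the crossed product -/

namespace CrossedProduct

variable {A : Type u} [CStarAlgebra A] (σ : A ≃⋆ₐ[ℂ] A) (hσ : σ ^ 2 = 1) {S T : A}

theorem W_mul_W : W σ hσ * W σ hσ = 1 := by rw [← pow_two, W_sq]

theorem star_W : star (W σ hσ) = W σ hσ := by
  calc star (W σ hσ) = star (W σ hσ) * (W σ hσ * W σ hσ) := by rw [W_mul_W, mul_one]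
    _ = W σ hσ := by rw [← mul_assoc, (Unitary.mem_iff.1 (W_mem_unitary σ hσ)).1, one_mul]

theorem isCuntzPair_ι_W (h : IsCuntzPair S T) (hST : σ S = T) :
    IsCuntzPair (ι σ hσ S) (W σ hσ * ι σ hσ S) := by
  have h1 : star (ι σ hσ S) * ι σ hσ S = 1 := by
    rw [← map_star, ← map_mul, h.isometry_left, map_one]
  refine ⟨h1, ?_, ?_⟩
  · rw [star_mul, star_W, mul_assoc, ← mul_assoc (W σ hσ), W_mul_W, one_mul, h1]
  · have e : W σ hσ * ι σ hσ S * star (W σ hσ * ι σ hσ S) = ι σ hσ (T * star T) := by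
      rw [← hST, ← map_star, ← map_mul, ← covariance, map_mul, map_star, star_mul]
      simp only [mul_assoc]
    rw [e, ← map_star, ← map_mul, ← map_add, h.cuntz_relation, map_one]

/-- Since `T = W S W`, one has `W T T* = S (W S)*`. Multiplying `W` by `S S* + T T* = 1` writes it
as `(W S) S* + S (W S)*`, so `W`, and then `T`, lie in any closed *-subalgebra containing the pair.
-/
theorem cstarGen_ι_W (h : IsCuntzPair S T) (hg : cstarGen ({S, T} : Set A) = ⊤) (hST : σ S = T) :
    cstarGen ({ι σ hσ S, W σ hσ * ι σ hσ S} : Set (CrossedProduct σ hσ)) = ⊤ := by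
  refine cstarGen_eq_top fun U hU h1 h2 => ?_
  have hT : ι σ hσ T = W σ hσ * ι σ hσ S * W σ hσ := by rw [← hST, ← covariance, star_W]
  have hW : W σ hσ = W σ hσ * ι σ hσ S * star (ι σ hσ S) +
      ι σ hσ S * star (W σ hσ * ι σ hσ S) := by
    have e : W σ hσ * (ι σ hσ T * star (ι σ hσ T)) = ι σ hσ S * star (W σ hσ * ι σ hσ S) := by
      rw [hT]
      simp only [star_mul, star_W]
      calc _ = (W σ hσ * W σ hσ) * ι σ hσ S * (W σ hσ * W σ hσ) * star (ι σ hσ S) * W σ hσ := by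
            noncomm_ring
        _ = _ := by rw [W_mul_W, one_mul, mul_one, mul_assoc]
    rw [← e, mul_assoc, ← mul_add, ← map_star, ← map_star, ← map_mul, ← map_mul, ← map_add,
      h.cuntz_relation, map_one, mul_one]
  have hWU : W σ hσ ∈ U := by
    rw [hW]
    exact add_mem (mul_mem h2 (star_mem h1)) (mul_mem h1 (star_mem h2))
  have hι : Continuous (ι σ hσ) := (ι σ hσ).continuous_of_cstarAlgebra
  have hA : cstarGen ({S, T} : Set A) ≤ U.comap (ι σ hσ) := by
    refine cstarGen_le_of_isClosed ?_ (hU.preimage hι)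
    rintro x (rfl | rfl)
    · exact h1
    · change ι σ hσ x ∈ U
      rw [hT]
      exact mul_mem h2 hWU
  rw [hg] at hA
  refine top_unique fun x _ => ?_
  obtain ⟨a, b, rfl⟩ := exists_eq_mk σ hσ x
  rw [mk_eq]
  exact add_mem (hA (trivial : a ∈ (⊤ : StarSubalgebra ℂ A)))
    (mul_mem (hA (trivial : b ∈ (⊤ : StarSubalgebra ℂ A))) hWU)

theorem nontrivial [Nontrivial A] : Nontrivial (CrossedProduct σ hσ) :=
  ⟨⟨0, 1, fun h => zero_ne_one (mk_inj σ hσ (by rw [mk_zero, mk_one, h])).1⟩⟩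

end CrossedProduct

/-! ### The main theorem -/

theorem mainTheorem2 {B : Type u} [CStarAlgebra B] [Nontrivial B] (S₁ S₂ : B)
    (hS : IsCuntzPair S₁ S₂) :
    (∃! σ : CStarPair S₁ S₂ ≃⋆ₐ[ℂ] CStarPair S₁ S₂,
      orderOf σ = 2 ∧ σ (CStarPair.fst S₁ S₂) = CStarPair.snd S₁ S₂) ∧
    ∀ (σ : CStarPair S₁ S₂ ≃⋆ₐ[ℂ] CStarPair S₁ S₂) (hσ : σ ^ 2 = 1),
      σ (CStarPair.fst S₁ S₂) = CStarPair.snd S₁ S₂ →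
        Nonempty (CrossedProduct σ hσ ≃⋆ₐ[ℂ] CStarPair S₁ S₂) ∧
        (cstarGen {CrossedProduct.ι σ hσ (CStarPair.fst S₁ S₂),
            CrossedProduct.W σ hσ * CrossedProduct.ι σ hσ (CStarPair.fst S₁ S₂)} :
          StarSubalgebra ℂ (CrossedProduct σ hσ)) = ⊤ ∧
        IsCuntzPair (CrossedProduct.ι σ hσ (CStarPair.fst S₁ S₂))
          (CrossedProduct.W σ hσ * CrossedProduct.ι σ hσ (CStarPair.fst S₁ S₂)) := by
  have h := hS.mk_subtype
  have hg := cstarGen_fst_snd S₁ S₂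
  have hext : ∀ σ τ : CStarPair S₁ S₂ ≃⋆ₐ[ℂ] CStarPair S₁ S₂,
      σ (CStarPair.fst S₁ S₂) = τ (CStarPair.fst S₁ S₂) →
      σ (CStarPair.snd S₁ S₂) = τ (CStarPair.snd S₁ S₂) → σ = τ := fun σ τ h1 h2 => by
    ext1 x
    exact DFunLike.congr_fun (StarAlgHom.ext_of_cstarGen_eq_top hg
      (φ := (σ : CStarPair S₁ S₂ →⋆ₐ[ℂ] CStarPair S₁ S₂)) (ψ := τ) h1 h2) x
  refine ⟨?_, fun σ hσ h12 => ?_⟩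
  -- Uniqueness of `𝒪₂` applied to the pair and its swap yields the flip automorphism.
  · obtain ⟨σ, h12, h21⟩ := h.exists_equiv h.symm hg ((congrArg cstarGen (Set.pair_comm _ _)).trans hg)
    refine ⟨σ, ⟨?_, h12⟩, ?_⟩
    · refine orderOf_eq_prime ?_ fun h1 => ?_
      · refine hext _ _ ?_ ?_
        · rw [pow_two]; change σ (σ _) = _; rw [h12, h21]; rfl
        · rw [pow_two]; change σ (σ _) = _; rw [h21, h12]; rfl
      · rw [h1] at h12
        exact h.ne h12
    · rintro τ ⟨hτ, hτ12⟩
      have hτ2 : τ ^ 2 = 1 := by rw [← hτ]; exact pow_orderOf_eq_one τ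
      refine hext _ _ (hτ12.trans h12.symm) ?_
      -- An involution that sends `S₁` to `S₂` must send `S₂` back to `S₁`.
      rw [h21, ← hτ12, StarAlgEquiv.apply_apply_of_sq_eq_one hτ2]
  · have hc := CrossedProduct.isCuntzPair_ι_W σ hσ h h12
    have hcg := CrossedProduct.cstarGen_ι_W σ hσ h hg h12
    have := CrossedProduct.nontrivial σ hσ
    obtain ⟨e, -, -⟩ := hc.exists_equiv h hcg hg
    exact ⟨⟨e⟩, hcg, hc⟩
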